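/- Let $G$ be a finite or countable graph in which every vertex $g$ has a finite set $O(g)$ of neighbours, and let $K\ge 1$. A probabilistic cellular automaton on $G$ is given by probability distributions $p_g(a,c;\cdot)$ on $\{1,\dots,K\}$, one for each vertex $g$, each state $a\in\{1,\dots,K\}$ of $g$ and each configuration $c\in\{1,\dots,K\}^{O(g)}$ of states of the neighbours. It is the Markov chain on $Y:=\{1,\dots,K\}^G$ in which, given the present configuration $v$, the new states of the vertices are chosen independently, the new state of $g$ having law $p_g(v(g),v|_{O(g)};\cdot)$. Let $P$ be its transfer operator on the space $\mathcal M(Y)$ of Borel probability measures on $Y$. Then there are a partition of $[0,1]$ into $K$ intervals $\Delta_1,\dots,\Delta_K$ of positive length and, for every vertex $g$ and every $c\in\{1,\dots,K\}^{O(g)}$, a map $\tau_{g,c}:[0,1]\to[0,1]$ (in total countably many maps) such that the following holds. Write $i(x)$ for the index with $x\in\Delta_{i(x)}$, put $X:=[0,1]^G$, and define $T:X\to X$ by $$(Tx)_g=\tau_{g,c}(x_g),\qquad c=(i(x_h))_{h\in O(g)} .$$ 1. Each $\tau_{g,c}$ is a piecewise linear Markov map: there is a finite partition of $[0,1]$ into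 nonempty (possibly one-point) intervals, refining $\{\Delta_i\}$, such that on each of its intervals $\tau_{g,c}$ is of the form $x\mapsto ax+b$ with $a\ne0$ and maps that interval onto a union of intervals of the partition. 2. $T$ is a deterministic dynamical system: it is Borel measurable, and nonsingular with respect to some Borel probability measure $m$ on $X$ (that is, $m(A)=0$ implies $m(T^{-1}A)=0$) such that the product Lebesgue measure on $X$ is absolutely continuous with respect to $m$; if $G$ is finite, $m$ is the Lebesgue measure. 3. The automaton is equivalent to $(T,X)$. Let $T^*\nu(A)=\nu(T^{-1}A)$, and let $\mathcal M_u$ be the set of piecewise uniform Borel probability measures on $X$, i.e. of those $\nu$ such that for every finite $F\subseteq G$, all indices $c_g$ and all intervals $I_g,I'_g\subseteq\Delta_{c_g}$ ($g\in F$), $$\nu\{x: x_g\in I_g\ \forall g\in F\}\prod_{g\in F}|I'_g|=\nu\{x: x_g\in I'_g\ \forall g\in F\}\prod_{g\in F}|I_g| .$$ There is a homeomorphism $\pi:\mathcal M(Y)\to\mathcal M_u$ for the weak topologies such that $\pi(P\mu)=T^*(\pi\mu)$ for all $\mu\in\mathcal M(Y)$; moreover $T^*\nu\in\mathcal M_u$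 and $P(\pi^{-1}\nu)=\pi^{-1}(T^*\nu)$ for all $\nu\in\mathcal M_u$; and for every $\mu\in\mathcal M(Y)$, the configuration $(i(x_g))_{g\in G}$ has law $\mu$ when $x$ has law $\pi\mu$. -/

import Mathlib

open MeasureTheory

/-- The unit interval `[0,1]`, with its Lebesgue measure `volume`. -/
abbrev UI : Type := unitInterval

/-- The local rule of a probabilistic cellular automaton on the graph `G` with states
`0, …, K - 1`: for every vertex `g`, every state of `g` and every configuration of states of the
neighbours of `g`, a probability distribution of the next state of `g`. -/
abbrev LocalRule {V : Type*} (G : SimpleGraph V) (K : ℕ) : Type _ :=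
  (g : V) → Fin K → (G.neighborSet g → Fin K) → PMF (Fin K)

namespace LocalRule

variable {V : Type*} {G : SimpleGraph V} {K : ℕ}

/-- The law of the next configuration, given the present configuration `v`: all the vertices are
updated simultaneously and independently. -/
noncomputable def stepLaw (p : LocalRule G K) (v : V → Fin K) : Measure (V → Fin K) :=
  Measure.infinitePi fun g => (p g (v g) fun h => v h).toMeasure

instance (p : LocalRule G K) (v : V → Fin K) : IsProbabilityMeasure (p.stepLaw v) := by
  unfold stepLaw; infer_instance

theorem measurable_local [G.LocallyFinite] {g : V}
    (q : Fin K → (G.neighborSet g → Fin K) → ENNReal) :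
    Measurable fun v : V → Fin K => q (v g) fun h => v h := by
  have h1 : Measurable (Function.uncurry q) := .of_discrete
  have h2 : Measurable fun v : V → Fin K =>
      ((v g, fun h => v h) : Fin K × (G.neighborSet g → Fin K)) :=
    Measurable.prodMk (by fun_prop) (by fun_prop)
  exact h1.comp h2

theorem stepLaw_pi (p : LocalRule G K) (v : V → Fin K) (s : Finset V) (t : V → Set (Fin K)) :
    p.stepLaw v ((s : Set V).pi t) = ∏ g ∈ s, (p g (v g) fun h => v h).toMeasure (t g) :=
  Measure.infinitePi_pi _ fun i _ => (Set.toFinite (t i)).measurableSet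

/-- The one-step law depends measurably on the present configuration. -/
theorem measurable_stepLaw [G.LocallyFinite] (p : LocalRule G K) : Measurable p.stepLaw := by
  refine Measurable.measure_of_isPiSystem_of_isProbabilityMeasure
    (generateFrom_squareCylinders (α := fun _ : V => Fin K)).symm
    (isPiSystem_squareCylinders (fun _ => MeasurableSpace.isPiSystem_measurableSet)
      (by simp)) ?_
  rintro _ ⟨s, t, -, rfl⟩
  simp only [stepLaw_pi]
  exact Finset.measurable_fun_prod _ fun g _ => measurable_local (fun a c => (p g a c).toMeasure (t g))

/-- The transfer operator `P_M` of the automaton, seen as a Markov chain on the space of all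
configurations: `P_M μ = ∫ stepLaw v dμ(v)`. -/
noncomputable def transfer [G.LocallyFinite] (p : LocalRule G K)
    (μ : ProbabilityMeasure (V → Fin K)) : ProbabilityMeasure (V → Fin K) :=
  ⟨(μ : Measure (V → Fin K)).bind p.stepLaw,
    isProbabilityMeasure_bind p.measurable_stepLaw.aemeasurable
      (Filter.Eventually.of_forall fun _ => inferInstance)⟩

end LocalRule

/-- A partition of `[0,1]` into disjoint nonempty intervals, indexed by `ι`. -/
structure IntervalPartition (ι : Type*) where
  /-- The intervals of the partition. -/
  cell : ι → Set UI
  ordConnected : ∀ i, (cell i).OrdConnected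
  nonempty : ∀ i, (cell i).Nonempty
  disjoint : Pairwise fun i j => Disjoint (cell i) (cell j)
  cover : ∀ x, ∃ i, x ∈ cell i

/-- The index of the interval of the partition that contains `x`. -/
noncomputable def IntervalPartition.index {ι : Type*} (Δ : IntervalPartition ι) (x : UI) : ι :=
  (Δ.cover x).choose

/-- The configuration of the indices of the intervals that contain the coordinates of `x`. -/
noncomputable def IntervalPartition.code {V ι : Type*} (Δ : IntervalPartition ι) (x : V → UI) :
    V → ι :=
  fun g => Δ.index (x g)

/-- `f : [0,1] → [0,1]` is a piecewise linear Markov map with a finite Markov partition that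
refines the partition `Δ`: `f` is affine and nonconstant on every interval of the Markov partition,
and maps it onto a union of intervals of the Markov partition. -/
def IsPiecewiseLinearMarkov {ι : Type*} (Δ : IntervalPartition ι) (f : UI → UI) : Prop :=
  ∃ (W : ℕ) (Δ' : IntervalPartition (Fin W)),
    (∀ i, ∃ j, Δ'.cell i ⊆ Δ.cell j) ∧
    (∀ i, ∃ a b : ℝ, a ≠ 0 ∧ ∀ x ∈ Δ'.cell i, (f x : ℝ) = a * x + b) ∧
    ∀ i, ∃ J : Set (Fin W), f '' Δ'.cell i = ⋃ j ∈ J, Δ'.cell j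

/-- The map of `[0,1]^G` in which the local map that is applied to the coordinate at `g` is
chosen according to the configuration of the coordinates at the neighbours of `g`. -/
noncomputable def globalMap {V : Type*} (G : SimpleGraph V) {K : ℕ} (Δ : IntervalPartition (Fin K))
    (τ : (g : V) → (G.neighborSet g → Fin K) → UI → UI) (x : V → UI) : V → UI :=
  fun g => τ g (fun h => Δ.index (x h)) (x g)

/-- The product `m^G` of the Lebesgue measures on `[0,1]^G`. -/
noncomputable def lebesgueProduct (V : Type*) : Measure (V → UI) :=
  Measure.infinitePi fun _ => (volume : Measure UI)

/-- The piecewise uniform measures on `[0,1]^G`: inside every product of intervals of `Δ`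
over finitely many coordinates, the masses of boxes are proportional to their volumes. -/
def piecewiseUniform (V : Type*) {ι : Type*} (Δ : IntervalPartition ι) :
    Set (ProbabilityMeasure (V → UI)) :=
  {ν | ∀ (F : Finset V) (c : V → ι) (A B : V → Set UI),
    (∀ g ∈ F, (A g).OrdConnected ∧ A g ⊆ Δ.cell (c g)) →
    (∀ g ∈ F, (B g).OrdConnected ∧ B g ⊆ Δ.cell (c g)) →
    (ν : Measure (V → UI)) ((F : Set V).pi A) * ∏ g ∈ F, volume (B g)
      = (ν : Measure (V → UI)) ((F : Set V).pi B) * ∏ g ∈ F, volume (A g)}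

/-- The induced map `T^*` on probability measures, `T^* ν (A) = ν (T⁻¹ A)`. -/
noncomputable def inducedMap {X : Type*} [MeasurableSpace X] {T : X → X} (hT : Measurable T)
    (ν : ProbabilityMeasure X) : ProbabilityMeasure X :=
  ν.map hT.aemeasurable

/-- A Markov chain with state space `Y` and transfer operator `P` is equivalent to the dynamical
system `(T, X)` by the homeomorphism `π` (for the weak topologies) from the probability measures
on `Y` onto the set `S` of probability measures on `X`: `π` conjugates `P` to the restriction of
`T^*` to `S`. -/
def IsEquivalence {X Y : Type*} [TopologicalSpace X] [MeasurableSpace X] [OpensMeasurableSpace X]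
    [TopologicalSpace Y] [MeasurableSpace Y] [OpensMeasurableSpace Y]
    (P : ProbabilityMeasure Y → ProbabilityMeasure Y) {T : X → X} (hT : Measurable T)
    (S : Set (ProbabilityMeasure X)) (π : ProbabilityMeasure Y ≃ₜ S) : Prop :=
  (∀ μ, (π (P μ) : ProbabilityMeasure X) = inducedMap hT (π μ)) ∧
  ∀ ν : S, ∃ h : inducedMap hT ν ∈ S, P (π.symm ν) = π.symm ⟨inducedMap hT ν, h⟩

/-! Replace each state `a` by the interval [a/K, (a+1)/K), the last one closed. A point of [0,1]^G
is then a configuration (its code) together with a relative position in [0,1] at every vertex, and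
`lift μ` makes the code have law μ and the positions independent, uniform and independent of the
code. These positions are the source of randomness. For a fixed vertex and neighbour configuration,
cut the cell of `a` into pieces of relative length q(a,b) and stretch each piece affinely onto the
cell of `b`. If the old position is uniform, the new state is `b` with probability q(a,b), and given
`b` the new position is again uniform (`volume_preimage_markovMap`).

Given the code, different vertices use independent positions, so the updates are independent, and
T^* carries `lift μ` to the lift of P μ (`inducedMap_lift`). The lifts are exactly the piecewise
uniform measures: inside products of cells such a measure is proportional to volume, so only the law
of the code is free (`eq_of_map_code_eq`). Compactness turns this bijection into a homeomorphism.

Nonsingularity: for finite G, Lebesgue measure is itself a lift, and all lifts are absolutely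
continuous with respect to it. In general, take m to be a weighted sum of the images of Lebesgue
measure under the iterates of T. -/

namespace IntervalPartition

variable {ι κ : Type*} (Δ : IntervalPartition ι)

theorem mem_index (x : UI) : x ∈ Δ.cell (Δ.index x) := (Δ.cover x).choose_spec

theorem index_eq_iff {x : UI} {i : ι} : Δ.index x = i ↔ x ∈ Δ.cell i := by
  refine ⟨fun h => h ▸ Δ.mem_index x, fun h => ?_⟩
  by_contra hne
  exact Set.disjoint_left.1 (Δ.disjoint hne) (Δ.mem_index x) h

theorem measurableSet_cell (i : ι) : MeasurableSet (Δ.cell i) :=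
  (Δ.ordConnected i).measurableSet

theorem measurable_index [Countable ι] [MeasurableSpace ι] : Measurable Δ.index := by
  refine measurable_to_countable' fun i => ?_
  have : Δ.index ⁻¹' {i} = Δ.cell i := by
    ext x
    simp [Δ.index_eq_iff]
  rw [this]
  exact Δ.measurableSet_cell i

theorem measurable_code {V : Type*} [Countable ι] [MeasurableSpace ι] :
    Measurable (Δ.code : (V → UI) → V → ι) :=
  measurable_pi_lambda _ fun g => Δ.measurable_index.comp (measurable_pi_apply g)

/-- The same partition with its cells indexed by another type. -/
def reindex (e : κ ≃ ι) : IntervalPartition κ where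
  cell k := Δ.cell (e k)
  ordConnected k := Δ.ordConnected _
  nonempty k := Δ.nonempty _
  disjoint k l h := Δ.disjoint (e.injective.ne h)
  cover x := (Δ.cover x).imp' e.symm fun i hi => by simpa using hi

end IntervalPartition

theorem IsPiecewiseLinearMarkov.measurable {ι : Type*} {Δ : IntervalPartition ι} {f : UI → UI}
    (hf : IsPiecewiseLinearMarkov Δ f) : Measurable f := by
  obtain ⟨W, Δ', -, h, -⟩ := hf
  choose a b _ hab using h
  have hi : Measurable Δ'.index := Δ'.measurable_index
  have : (fun x => (f x : ℝ)) = fun x : UI => a (Δ'.index x) * (x : ℝ) + b (Δ'.index x) :=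
    funext fun x => hab _ x (Δ'.mem_index x)
  refine unitInterval.measurableEmbedding_coe.measurable_comp_iff.1 ?_
  change Measurable fun x => (f x : ℝ)
  rw [this]
  exact (((Measurable.of_discrete (f := a)).comp hi).mul measurable_subtype_coe).add
    ((Measurable.of_discrete (f := b)).comp hi)

open scoped Pointwise in
/-- An increasing affine self-map of the unit interval scales volumes by its slope. -/
theorem volume_image_affine {ψ : UI → UI} {s r : ℝ} (hr : 0 ≤ r)
    (hψ : ∀ t, (ψ t : ℝ) = s + r * t) (E : Set UI) :
    volume (ψ '' E) = ENNReal.ofReal r * volume E := by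
  rw [unitInterval.volume_apply, unitInterval.volume_apply]
  have : Subtype.val '' (ψ '' E) = (fun x => s + x) '' (r • (Subtype.val '' E)) := by
    rw [← Set.image_smul, Set.image_image, Set.image_image, Set.image_image]
    simp [hψ]
  rw [this, Set.image_add_left, measure_preimage_add, Measure.addHaar_smul_of_nonneg _ hr]
  simp

/-! ### The partition into equal cells and its affine charts. -/

section EqualPartition

variable {K : ℕ}

/-- The increasing affine map of the unit interval onto the closure `[a/K, (a+1)/K]` of the
`a`-th cell of the partition into `K` intervals of equal length. -/
noncomputable def cellMap (a : Fin K) (u : UI) : UI :=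
  ⟨(a + u) / K, by
    have hK : (0 : ℝ) < K := by exact_mod_cast a.pos
    have ha : (a : ℝ) + 1 ≤ K := by exact_mod_cast a.isLt
    have := u.2.1
    have := u.2.2
    constructor
    · positivity
    · rw [div_le_one hK]; linarith⟩

@[simp] theorem coe_cellMap (a : Fin K) (u : UI) : (cellMap a u : ℝ) = (a + u) / K := rfl

theorem mul_coe_cellMap (a : Fin K) (u : UI) : (K : ℝ) * cellMap a u = a + u := by
  have hK : (K : ℝ) ≠ 0 := by exact_mod_cast a.pos.ne'
  rw [coe_cellMap]
  field_simp

theorem continuous_cellMap (a : Fin K) : Continuous (cellMap a) := by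
  unfold cellMap
  fun_prop

theorem continuous_uncurry_cellMap : Continuous fun z : Fin K × UI => cellMap z.1 z.2 :=
  continuous_prod_of_discrete_left.2 continuous_cellMap

/-- The partition of the unit interval into `K` intervals of equal length, all of them half-open
except for the last one. -/
def equalPartition (hK : 0 < K) : IntervalPartition (Fin K) where
  cell i := {x | (i : ℝ) ≤ K * x ∧ ((K : ℝ) * x < i + 1 ∨ (i : ℕ) + 1 = K)}
  ordConnected i := by
    refine ⟨fun x hx y hy z hz => ?_⟩
    have h1 : (x : ℝ) ≤ z := hz.1
    have h2 : (z : ℝ) ≤ y := hz.2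
    have hK' : (0 : ℝ) < K := by exact_mod_cast hK
    refine ⟨hx.1.trans (by gcongr), hy.2.imp (fun h => lt_of_le_of_lt (by gcongr) h) id⟩
  nonempty i := by
    refine ⟨cellMap i 0, ?_⟩
    rw [Set.mem_ofPred_eq, mul_coe_cellMap]
    simp
  disjoint := by
    have key : ∀ i j : Fin K, i < j → ∀ x : UI,
        ((K : ℝ) * x < i + 1 ∨ (i : ℕ) + 1 = K) → (j : ℝ) ≤ K * x → False := by
      intro i j hij x hx hj
      have hij' : (i : ℕ) + 1 ≤ j := hij
      rcases hx with hx | hx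
      · have : (i : ℝ) + 1 ≤ j := by exact_mod_cast hij'
        linarith
      · have := j.isLt
        omega
    intro i j hij
    refine Set.disjoint_left.2 fun x hi hj => ?_
    rcases hij.lt_or_gt with h | h
    · exact key i j h x hi.2 hj.1
    · exact key j i h x hj.2 hi.1
  cover x := by
    have hK' : (0 : ℝ) < K := by exact_mod_cast hK
    rcases x.2.2.lt_or_eq with hx | hx
    · have h0 : (0 : ℝ) ≤ K * x := mul_nonneg hK'.le x.2.1
      have h1 : (K : ℝ) * x < K := by nlinarith
      exact ⟨⟨⌊(K : ℝ) * x⌋₊, (Nat.floor_lt h0).2 h1⟩, Nat.floor_le h0,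
        Or.inl (Nat.lt_floor_add_one _)⟩
    · refine ⟨⟨K - 1, by omega⟩, ?_, Or.inr ?_⟩
      · change ((K - 1 : ℕ) : ℝ) ≤ K * (x : ℝ)
        rw [hx, mul_one]
        exact_mod_cast Nat.sub_le K 1
      · change K - 1 + 1 = K
        omega

theorem cellMap_mem (hK : 0 < K) (a : Fin K) {u : UI} (hu : u < 1) :
    cellMap a u ∈ (equalPartition hK).cell a := by
  have h0 := u.2.1
  have h1 : (u : ℝ) < 1 := hu
  refine ⟨?_, Or.inl ?_⟩ <;> rw [mul_coe_cellMap] <;> linarith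

theorem cell_subset_range_cellMap (hK : 0 < K) (a : Fin K) :
    (equalPartition hK).cell a ⊆ Set.range (cellMap a) := by
  rintro x ⟨h1, h2⟩
  have hK' : (0 : ℝ) < K := by exact_mod_cast hK
  have h3 : (K : ℝ) * x ≤ a + 1 := by
    rcases h2 with h2 | h2
    · exact h2.le
    · have : (a : ℝ) + 1 = K := by exact_mod_cast h2
      have := x.2.2
      nlinarith
  refine ⟨⟨K * x - a, by linarith, by linarith⟩, Subtype.ext ?_⟩
  rw [coe_cellMap]
  field_simp
  ring

theorem ae_lt_one : ∀ᵐ u : UI, u < 1 := by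
  have h : ∀ᵐ u : UI, u ≠ 1 := by simp [ae_iff]
  filter_upwards [h] with u hu
  exact lt_of_le_of_ne u.2.2 hu

/-- The chart of the `a`-th cell contracts lengths by K. It can leave that cell only at `u = 1`, a
null set, so the other cells contribute nothing. -/
theorem volume_preimage_cellMap (hK : 0 < K) (a c : Fin K) {A : Set UI}
    (hA : A ⊆ (equalPartition hK).cell c) :
    volume (cellMap a ⁻¹' A) = (if a = c then (K : ENNReal) else 0) * volume A := by
  have hK' : (0 : ℝ) < K := by exact_mod_cast hK
  split_ifs with h
  · subst h
    have h1 := volume_image_affine (ψ := cellMap a) (s := a / K) (r := (K : ℝ)⁻¹) (by positivity)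
      (fun t => by rw [coe_cellMap]; ring) (cellMap a ⁻¹' A)
    rw [Set.image_preimage_eq_of_subset (hA.trans (cell_subset_range_cellMap hK a)),
      ENNReal.ofReal_inv_of_pos hK', ENNReal.ofReal_natCast] at h1
    rw [h1, ← mul_assoc, ENNReal.mul_inv_cancel (by exact_mod_cast hK.ne') (by simp), one_mul]
  · rw [zero_mul, measure_eq_zero_iff_ae_notMem]
    filter_upwards [ae_lt_one] with u hu hmem
    exact Set.disjoint_left.1 ((equalPartition hK).disjoint h) (cellMap_mem hK a hu) (hA hmem)

theorem volume_cell_pos (hK : 0 < K) (a : Fin K) : 0 < volume ((equalPartition hK).cell a) := by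
  have h1 : volume (cellMap a ⁻¹' (equalPartition hK).cell a) = 1 := by
    rw [prob_compl_eq_zero_iff
      ((continuous_cellMap a).measurable ((equalPartition hK).measurableSet_cell a)) |>.symm,
      measure_eq_zero_iff_ae_notMem]
    filter_upwards [ae_lt_one] with u hu hmem
    exact hmem (cellMap_mem hK a hu)
  rw [volume_preimage_cellMap hK a a subset_rfl] at h1
  refine pos_iff_ne_zero.2 fun h => ?_
  simp [h] at h1

end EqualPartition

/-! ### Cumulative sums cut [0,1) into pieces of prescribed lengths. -/

namespace PMF

variable {K : ℕ} (q : PMF (Fin K))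

/-- The total probability of the states before `b`. -/
noncomputable def cumul (b : Fin K) : ℝ := ∑ b' ∈ Finset.Iio b, (q b').toReal

theorem cumul_nonneg (b : Fin K) : 0 ≤ q.cumul b :=
  Finset.sum_nonneg fun _ _ => ENNReal.toReal_nonneg

theorem sum_toReal : ∑ b, (q b).toReal = 1 := by
  rw [← ENNReal.toReal_sum fun b _ => q.apply_ne_top b, ← tsum_fintype (L := .unconditional _),
    q.tsum_coe, ENNReal.toReal_one]

theorem cumul_add (b : Fin K) :
    q.cumul b + (q b).toReal = ∑ b' ∈ Finset.Iic b, (q b').toReal := by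
  rw [← Finset.Iio_insert, Finset.sum_insert (by simp), add_comm, cumul]

theorem cumul_add_le {b b' : Fin K} (h : b < b') : q.cumul b + (q b).toReal ≤ q.cumul b' := by
  rw [cumul_add]
  refine Finset.sum_le_sum_of_subset_of_nonneg (fun x hx => ?_) fun _ _ _ => ENNReal.toReal_nonneg
  exact Finset.mem_Iio.2 ((Finset.mem_Iic.1 hx).trans_lt h)

theorem cumul_add_le_one (b : Fin K) : q.cumul b + (q b).toReal ≤ 1 := by
  rw [cumul_add, ← q.sum_toReal]
  exact Finset.sum_le_sum_of_subset_of_nonneg (Finset.subset_univ _)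
    fun _ _ _ => ENNReal.toReal_nonneg

/-- Each piece begins where the previous one ends. If `u` were in none, induction would push it past
every piece, and the last one ends at 1. -/
theorem exists_cumul_le_lt {u : ℝ} (h0 : 0 ≤ u) (h1 : u < 1) :
    ∃ b, q.cumul b ≤ u ∧ u < q.cumul b + (q b).toReal := by
  by_contra! hcon
  have key : ∀ n (hn : n < K), q.cumul ⟨n, hn⟩ ≤ u := by
    intro n
    induction n with
    | zero =>
      intro hn
      have : Finset.Iio (⟨0, hn⟩ : Fin K) = ∅ := by
        ext x
        simp [Fin.lt_def]
      simpa [cumul, this] using h0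
    | succ n ih =>
      intro hn
      refine le_trans (le_of_eq ?_) (hcon ⟨n, by omega⟩ (ih _))
      rw [cumul_add, cumul]
      congr 1
      ext x
      simp [Fin.lt_def, Fin.le_def]
  obtain ⟨b, -⟩ := q.support_nonempty
  have hK := b.pos
  have := hcon ⟨K - 1, by omega⟩ (key _ _)
  rw [cumul_add] at this
  have huniv : Finset.Iic (⟨K - 1, by omega⟩ : Fin K) = Finset.univ := by
    ext x
    simp only [Finset.mem_Iic, Fin.le_def, Finset.mem_univ, iff_true]
    omega
  rw [huniv, q.sum_toReal] at this
  linarith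

theorem eq_of_cumul_le_lt {u : ℝ} {b b' : Fin K} (h1 : q.cumul b ≤ u)
    (h2 : u < q.cumul b + (q b).toReal) (h3 : q.cumul b' ≤ u)
    (h4 : u < q.cumul b' + (q b').toReal) : b = b' := by
  rcases lt_trichotomy b b' with h | h | h
  · have := q.cumul_add_le h
    linarith
  · exact h
  · have := q.cumul_add_le h
    linarith

end PMF

/-! ### The local Markov map and its action on uniform positions. -/

section MarkovMap

variable {K : ℕ} (q : Fin K → PMF (Fin K))

/-- The pairs of states between which a transition has positive probability, and a further index
for the endpoint `1`. -/
abbrev TransitionIndex : Type := Option {ab : Fin K × Fin K // q ab.1 ab.2 ≠ 0}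

/-- The part of the `a`-th cell that is to be mapped onto the `b`-th cell. -/
def transitionCell (a b : Fin K) : Set UI :=
  {x | a + (q a).cumul b ≤ (K : ℝ) * x ∧ (K : ℝ) * x < a + ((q a).cumul b + (q a b).toReal)}

theorem exists_mem_transitionCell {a : Fin K} {x : UI} (h1 : (a : ℝ) ≤ K * x)
    (h2 : (K : ℝ) * x < a + 1) : ∃ b, q a b ≠ 0 ∧ x ∈ transitionCell q a b := by
  obtain ⟨b, hb1, hb2⟩ := (q a).exists_cumul_le_lt (u := K * x - a) (by linarith) (by linarith)
  refine ⟨b, fun h0 => ?_, ?_, ?_⟩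
  · rw [h0, ENNReal.toReal_zero] at hb2
    linarith
  · linarith
  · linarith

theorem transitionCell_bounds {a b : Fin K} {x : UI} (h : x ∈ transitionCell q a b) :
    (a : ℝ) ≤ K * x ∧ (K : ℝ) * x < a + 1 := by
  have h1 := (q a).cumul_nonneg b
  have h2 := (q a).cumul_add_le_one b
  exact ⟨by linarith [h.1], by linarith [h.2]⟩

theorem one_notMem_transitionCell (a b : Fin K) : (1 : UI) ∉ transitionCell q a b := by
  intro h
  have h1 := (transitionCell_bounds q h).2
  have h2 : (a : ℝ) + 1 ≤ K := by exact_mod_cast a.isLt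
  rw [Set.Icc.coe_one, mul_one] at h1
  linarith

theorem eq_of_mem_transitionCell {a b a' b' : Fin K} {x : UI} (h : x ∈ transitionCell q a b)
    (h' : x ∈ transitionCell q a' b') : a = a' ∧ b = b' := by
  have haa : a = a' := by
    obtain ⟨h1, h2⟩ := transitionCell_bounds q h
    obtain ⟨h3, h4⟩ := transitionCell_bounds q h'
    have h5 : (a : ℝ) < a' + 1 := by linarith
    have h6 : (a' : ℝ) < a + 1 := by linarith
    have h7 : (a : ℕ) < a' + 1 := by exact_mod_cast h5
    have h8 : (a' : ℕ) < a + 1 := by exact_mod_cast h6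
    ext
    omega
  subst haa
  refine ⟨rfl, (q a).eq_of_cumul_le_lt (u := K * x - a) ?_ ?_ ?_ ?_⟩
  · linarith [h.1]
  · linarith [h.2]
  · linarith [h'.1]
  · linarith [h'.2]

theorem toReal_pos_of_ne {a b : Fin K} (h : q a b ≠ 0) : 0 < (q a b).toReal :=
  ENNReal.toReal_pos h ((q a).apply_ne_top b)

/-- The increasing affine map of the unit interval onto the closure of the set of those relative
positions in the `a`-th cell that are to be mapped into the `b`-th cell. -/
noncomputable def transitionMap (a b : Fin K) (t : UI) : UI :=
  ⟨(q a).cumul b + (q a b).toReal * t, by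
    have h1 := (q a).cumul_nonneg b
    have h2 := (q a).cumul_add_le_one b
    have h3 : 0 ≤ (q a b).toReal := ENNReal.toReal_nonneg
    have h4 := t.2.1
    have h5 := t.2.2
    constructor
    · positivity
    · nlinarith⟩

theorem coe_transitionMap (a b : Fin K) (t : UI) :
    (transitionMap q a b t : ℝ) = (q a).cumul b + (q a b).toReal * t := rfl

theorem cellMap_transitionMap_mem {a b : Fin K} (h : q a b ≠ 0) {t : UI} (ht : t < 1) :
    cellMap a (transitionMap q a b t) ∈ transitionCell q a b := by
  have h1 : (t : ℝ) < 1 := ht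
  have h2 := t.2.1
  have h3 := toReal_pos_of_ne q h
  have h4 : (q a b).toReal * t < (q a b).toReal := by nlinarith
  have h5 : 0 ≤ (q a b).toReal * t := by positivity
  constructor <;> rw [mul_coe_cellMap, coe_transitionMap] <;> linarith

theorem exists_of_mem_transitionCell {a b : Fin K} {u : UI}
    (h : cellMap a u ∈ transitionCell q a b) : ∃ t < 1, u = transitionMap q a b t := by
  obtain ⟨h1, h2⟩ := h
  rw [mul_coe_cellMap] at h1 h2
  have h3 : 0 < (q a b).toReal := by linarith
  have h4 : (u - (q a).cumul b) / (q a b).toReal < 1 := by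
    rw [div_lt_one h3]; linarith
  refine ⟨⟨(u - (q a).cumul b) / (q a b).toReal, div_nonneg (by linarith) h3.le, h4.le⟩, h4, ?_⟩
  ext
  rw [coe_transitionMap]
  field_simp
  ring

/-- The partition into the intervals `transitionCell q a b` and the endpoint `1`. -/
def transitionPartition (hK : 0 < K) : IntervalPartition (TransitionIndex q) where
  -- The pieces are right-open even in the last cell, so the endpoint 1 needs a cell of its own.
  -- Pieces of probability zero are empty, which is why the index type omits them.
  cell i := i.elim {1} fun ab => transitionCell q ab.1.1 ab.1.2
  ordConnected i := by
    cases i with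
    | none => exact Set.ordConnected_singleton
    | some ab =>
      refine ⟨fun x hx y hy z hz => ?_⟩
      have h1 : (x : ℝ) ≤ z := hz.1
      have h2 : (z : ℝ) ≤ y := hz.2
      exact ⟨hx.1.trans (by gcongr), lt_of_le_of_lt (by gcongr) hy.2⟩
  nonempty i := by
    cases i with
    | none => exact Set.singleton_nonempty _
    | some ab => exact ⟨_, cellMap_transitionMap_mem q ab.2 zero_lt_one⟩
  disjoint i j hij := by
    refine Set.disjoint_left.2 fun x hi hj => ?_
    cases i with
    | none =>
      cases j with
      | none => exact hij rfl
      | some cd => exact one_notMem_transitionCell q _ _ (Set.mem_singleton_iff.1 hi ▸ hj)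
    | some ab =>
      cases j with
      | none => exact one_notMem_transitionCell q _ _ (Set.mem_singleton_iff.1 hj ▸ hi)
      | some cd =>
        obtain ⟨h1, h2⟩ := eq_of_mem_transitionCell q hi hj
        exact hij (congrArg some (Subtype.ext (Prod.ext h1 h2)))
  cover x := by
    rcases x.2.2.lt_or_eq with hx | hx
    · obtain ⟨a, h1, h2⟩ := (equalPartition hK).cover x
      have h3 : (K : ℝ) * x < a + 1 := by
        rcases h2 with h2 | h2
        · exact h2
        · have h4 : (a : ℝ) + 1 = K := by exact_mod_cast h2
          have hK' : (0 : ℝ) < K := by exact_mod_cast hK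
          rw [h4]
          nlinarith
      obtain ⟨b, hb, hmem⟩ := exists_mem_transitionCell q h1 h3
      exact ⟨some ⟨(a, b), hb⟩, hmem⟩
    · exact ⟨none, Subtype.ext hx⟩

/-- The piecewise linear map that fixes `1` and maps every interval `transitionCell q a b`
affinely onto the interval `[b/K, (b+1)/K)`. -/
noncomputable def markovMap (hK : 0 < K) (x : UI) : UI :=
  match (transitionPartition q hK).index x with
  | none => 1
  -- On the piece in question the argument already lies in [0,1), so the projection changes nothing.
  | some ab => cellMap ab.1.2 (Set.projIcc 0 1 zero_le_one
      ((K * x - ab.1.1 - (q ab.1.1).cumul ab.1.2) / (q ab.1.1 ab.1.2).toReal))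

theorem markovMap_one (hK : 0 < K) : markovMap q hK 1 = 1 := by
  have : (transitionPartition q hK).index 1 = none :=
    (IntervalPartition.index_eq_iff _).2 (Set.mem_singleton _)
  simp only [markovMap, this]

theorem markovMap_cellMap (hK : 0 < K) {a b : Fin K} (h : q a b ≠ 0) {t : UI} (ht : t < 1) :
    markovMap q hK (cellMap a (transitionMap q a b t)) = cellMap b t := by
  have h1 : (transitionPartition q hK).index (cellMap a (transitionMap q a b t))
      = some ⟨(a, b), h⟩ :=
    (IntervalPartition.index_eq_iff _).2 (cellMap_transitionMap_mem q h ht)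
  have h2 := toReal_pos_of_ne q h
  simp only [markovMap, h1]
  congr 1
  rw [mul_coe_cellMap, coe_transitionMap]
  have h3 : ((a : ℝ) + ((q a).cumul b + (q a b).toReal * t) - a - (q a).cumul b)
      / (q a b).toReal = t := by
    field_simp
    ring
  rw [h3]
  exact Set.projIcc_val _ t

theorem exists_of_mem_transitionCell' {a b : Fin K} {x : UI} (h : x ∈ transitionCell q a b) :
    ∃ t < 1, x = cellMap a (transitionMap q a b t) := by
  obtain ⟨h1, h2⟩ := transitionCell_bounds q h
  obtain ⟨u, rfl⟩ := cell_subset_range_cellMap a.pos a (show x ∈ _ from ⟨h1, Or.inl h2⟩)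
  obtain ⟨t, ht, rfl⟩ := exists_of_mem_transitionCell q h
  exact ⟨t, ht, rfl⟩

theorem isPiecewiseLinearMarkov_markovMap (hK : 0 < K) :
    IsPiecewiseLinearMarkov (equalPartition hK) (markovMap q hK) := by
  classical
  have hK' : (0 : ℝ) < K := by exact_mod_cast hK
  let e := (Fintype.equivFin (TransitionIndex q)).symm
  refine ⟨_, (transitionPartition q hK).reindex e, fun i => ?_, fun i => ?_, fun i => ?_⟩
  · change ∃ j, (transitionPartition q hK).cell (e i) ⊆ _
    generalize e i = k
    cases k with
    | none =>
      obtain ⟨j, hj⟩ := (equalPartition hK).cover 1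
      exact ⟨j, Set.singleton_subset_iff.2 hj⟩
    | some ab =>
      exact ⟨ab.1.1, fun x hx =>
        ⟨(transitionCell_bounds q hx).1, Or.inl (transitionCell_bounds q hx).2⟩⟩
  · change ∃ a b : ℝ, a ≠ 0 ∧ ∀ x ∈ (transitionPartition q hK).cell (e i), _
    generalize e i = k
    cases k with
    | none =>
      refine ⟨1, 0, one_ne_zero, fun x hx => ?_⟩
      rw [Set.mem_singleton_iff.1 hx, markovMap_one]
      simp
    | some ab =>
      obtain ⟨⟨a, b⟩, hab⟩ := ab
      have h2 := toReal_pos_of_ne q hab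
      -- Since all cells have the same length, the slope is the same in x as in relative positions;
      -- the intercept comes from expanding `(b + (K x - a - cumul b) / q a b) / K`.
      refine ⟨((q a b).toReal)⁻¹, (b - (a + (q a).cumul b) / (q a b).toReal) / K, by positivity,
        fun x hx => ?_⟩
      obtain ⟨t, ht, rfl⟩ := exists_of_mem_transitionCell' q hx
      rw [markovMap_cellMap q hK hab ht, coe_cellMap, coe_cellMap, coe_transitionMap]
      field_simp
      ring
  · change ∃ J : Set _, _ '' (transitionPartition q hK).cell (e i) =
      ⋃ j ∈ J, (transitionPartition q hK).cell (e j)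
    generalize e i = k
    cases k with
    | none =>
      refine ⟨{e.symm none}, ?_⟩
      change _ '' {1} = _
      rw [Set.image_singleton, markovMap_one]
      simp [transitionPartition]
    | some ab =>
      obtain ⟨⟨a, b⟩, hab⟩ := ab
      -- The image is the whole of [b/K, (b+1)/K), which is the union of the nonempty pieces
      -- starting from state `b`.
      refine ⟨{j | ∃ c, ∃ h : q b c ≠ 0, e j = some ⟨(b, c), h⟩}, ?_⟩
      ext y
      simp only [Set.mem_iUnion, Set.mem_image, exists_prop, Set.mem_ofPred_eq]
      constructor
      · rintro ⟨x, hx, rfl⟩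
        obtain ⟨t, ht, rfl⟩ := exists_of_mem_transitionCell' q hx
        rw [markovMap_cellMap q hK hab ht]
        have h0 := t.2.1
        have h1 : (t : ℝ) < 1 := ht
        obtain ⟨c, hc, hmem⟩ := exists_mem_transitionCell q (a := b) (x := cellMap b t)
          (by rw [mul_coe_cellMap]; linarith) (by rw [mul_coe_cellMap]; linarith)
        refine ⟨e.symm (some ⟨(b, c), hc⟩), ⟨c, hc, by simp⟩, ?_⟩
        rw [Equiv.apply_symm_apply]
        exact hmem
      · rintro ⟨j, ⟨c, hc, hj⟩, hy⟩
        rw [hj] at hy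
        obtain ⟨h1, h2⟩ := transitionCell_bounds q hy
        obtain ⟨t, rfl⟩ := cell_subset_range_cellMap hK b (show y ∈ _ from ⟨h1, Or.inl h2⟩)
        rw [mul_coe_cellMap] at h2
        have ht : t < 1 := by
          change (t : ℝ) < 1
          linarith
        exact ⟨_, cellMap_transitionMap_mem q hab ht, markovMap_cellMap q hK hab ht⟩

/-- The relative positions sent to the `b`-th cell form an interval of length `q a b`, and rescaling
it to [0,1) turns the uniform law into the uniform law. This is how a deterministic map simulates
one random transition. -/
theorem volume_preimage_markovMap (hK : 0 < K) (a : Fin K) {E : Set UI} (hE : MeasurableSet E) :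
    volume ((fun u => markovMap q hK (cellMap a u)) ⁻¹' E)
      = ∑ b, q a b * volume (cellMap b ⁻¹' E) := by
  have hf : Measurable fun u => markovMap q hK (cellMap a u) :=
    (isPiecewiseLinearMarkov_markovMap q hK).measurable.comp (continuous_cellMap a).measurable
  have hcell : ∀ b, MeasurableSet (cellMap a ⁻¹' transitionCell q a b) := by
    intro b
    refine (continuous_cellMap a).measurable (Set.OrdConnected.measurableSet ?_)
    refine ⟨fun x hx y hy z hz => ?_⟩
    have h1 : (x : ℝ) ≤ z := hz.1
    have h2 : (z : ℝ) ≤ y := hz.2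
    exact ⟨hx.1.trans (by gcongr), lt_of_le_of_lt (by gcongr) hy.2⟩
  have hsplit : (fun u => markovMap q hK (cellMap a u)) ⁻¹' E =ᵐ[volume]
      (⋃ b, (fun u => markovMap q hK (cellMap a u)) ⁻¹' E ∩
        (cellMap a ⁻¹' transitionCell q a b) : Set UI) := by
    rw [← Set.inter_iUnion]
    refine Filter.EventuallyEq.symm (inter_ae_eq_left_of_ae_eq_univ ?_)
    rw [ae_eq_univ, measure_eq_zero_iff_ae_notMem]
    filter_upwards [ae_lt_one] with u hu hmem
    have h0 := u.2.1
    have h1 : (u : ℝ) < 1 := hu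
    obtain ⟨b, -, hb⟩ := exists_mem_transitionCell q (a := a) (x := cellMap a u)
      (by rw [mul_coe_cellMap]; linarith) (by rw [mul_coe_cellMap]; linarith)
    exact hmem (Set.mem_iUnion.2 ⟨b, hb⟩)
  rw [measure_congr hsplit, measure_iUnion, tsum_fintype]
  · refine Finset.sum_congr rfl fun b _ => ?_
    -- Inverting the affine branch presents this part of the preimage as an affine image, whose
    -- volume is scaled by `q a b`.
    have himage : (fun u => markovMap q hK (cellMap a u)) ⁻¹' E ∩
        (cellMap a ⁻¹' transitionCell q a b)
        = if q a b = 0 then ∅ else transitionMap q a b '' (cellMap b ⁻¹' E ∩ {t | t < 1}) := by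
      ext u
      split_ifs with h0
      · simp only [Set.mem_inter_iff, Set.mem_empty_iff_false, iff_false, not_and]
        intro _ hu
        have h1 := hu.1
        have h2 := hu.2
        rw [h0, ENNReal.toReal_zero] at h2
        linarith
      · constructor
        · rintro ⟨h1, h2⟩
          obtain ⟨t, ht, rfl⟩ := exists_of_mem_transitionCell q h2
          refine ⟨t, ⟨?_, ht⟩, rfl⟩
          rw [Set.mem_preimage, markovMap_cellMap q hK h0 ht] at h1
          exact h1
        · rintro ⟨t, ⟨h1, ht⟩, rfl⟩
          refine ⟨?_, cellMap_transitionMap_mem q h0 ht⟩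
          rw [Set.mem_preimage, markovMap_cellMap q hK h0 ht]
          exact h1
    rw [himage]
    split_ifs with h0
    · simp [h0]
    · rw [volume_image_affine ENNReal.toReal_nonneg (coe_transitionMap q a b),
        ENNReal.ofReal_toReal ((q a).apply_ne_top b)]
      congr 1
      exact measure_congr (inter_ae_eq_left_of_ae_eq_univ
        (Filter.eventuallyEq_univ.2 ae_lt_one))
  · intro b b' hbb
    refine Set.disjoint_left.2 fun u h1 h2 => ?_
    exact hbb (eq_of_mem_transitionCell q h1.2 h2.2).2
  · exact fun b => (hf hE).inter (hcell b)

end MarkovMap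

/-! ### Piecewise uniform measures are determined by the law of the code. -/

section PiecewiseUniform

variable {V ι : Type*}

/-- The intervals that are contained in one cell of a countable partition generate the Borel
sets. -/
theorem measurableSpace_le_generateFrom_cells [Countable ι] (Δ : IntervalPartition ι) :
    (inferInstance : MeasurableSpace UI) ≤ MeasurableSpace.generateFrom
      {A : Set UI | A = Set.univ ∨ ∃ i, A.OrdConnected ∧ A ⊆ Δ.cell i} := by
  rw [BorelSpace.measurable_eq (α := UI), borel_eq_generateFrom_Iic]
  refine MeasurableSpace.generateFrom_le ?_
  rintro _ ⟨x, rfl⟩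
  have : Set.Iic x = ⋃ i, Set.Iic x ∩ Δ.cell i := by
    rw [← Set.inter_iUnion, Set.iUnion_eq_univ_iff.2 Δ.cover, Set.inter_univ]
  rw [this]
  refine MeasurableSet.iUnion fun i => MeasurableSpace.measurableSet_generateFrom
    (Or.inr ⟨i, Set.ordConnected_Iic.inter (Δ.ordConnected i), Set.inter_subset_right⟩)

/-- The whole interval is included to allow unconstrained coordinates. Intervals in different cells
meet in the empty set, which is also order connected. -/
theorem isPiSystem_cells (Δ : IntervalPartition ι) :
    IsPiSystem {A : Set UI | A = Set.univ ∨ ∃ i, A.OrdConnected ∧ A ⊆ Δ.cell i} := by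
  rintro A (rfl | ⟨i, hA, hAi⟩) B hB -
  · simpa using hB
  · rcases hB with rfl | ⟨j, hB, -⟩
    · exact Or.inr ⟨i, by simpa using hA, by simpa using hAi⟩
    · exact Or.inr ⟨i, hA.inter hB, Set.inter_subset_left.trans hAi⟩

theorem generateFrom_squareCylinders_cells [Countable ι] (Δ : IntervalPartition ι) :
    (MeasurableSpace.pi : MeasurableSpace (V → UI)) = MeasurableSpace.generateFrom
      (squareCylinders fun _ : V =>
        {A : Set UI | A = Set.univ ∨ ∃ i, A.OrdConnected ∧ A ⊆ Δ.cell i}) := by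
  apply le_antisymm
  · refine iSup_le fun g => ?_
    refine (MeasurableSpace.comap_mono (measurableSpace_le_generateFrom_cells Δ)).trans ?_
    rw [MeasurableSpace.comap_generateFrom]
    refine MeasurableSpace.generateFrom_mono ?_
    rintro _ ⟨A, hA, rfl⟩
    exact ⟨{g}, fun _ => A, fun _ _ => hA, by ext; simp⟩
  · refine MeasurableSpace.generateFrom_le ?_
    rintro _ ⟨F, A, hA, rfl⟩
    refine MeasurableSet.pi F.countable_toSet fun g _ => ?_
    rcases hA g trivial with h | ⟨i, h, -⟩
    · rw [h]
      exact MeasurableSet.univ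
    · exact h.measurableSet

/-- A piecewise uniform measure is determined by the law of the code. -/
theorem eq_of_map_code_eq [Countable ι] [MeasurableSpace ι] [MeasurableSingletonClass ι]
    {Δ : IntervalPartition ι} (hΔ : ∀ i, 0 < volume (Δ.cell i))
    {ν ν' : ProbabilityMeasure (V → UI)}
    (hν : ν ∈ piecewiseUniform V Δ) (hν' : ν' ∈ piecewiseUniform V Δ)
    (h : (ν : Measure (V → UI)).map Δ.code = (ν' : Measure (V → UI)).map Δ.code) : ν = ν' := by
  classical
  suffices hνν : (ν : Measure (V → UI)) = ν' from Subtype.ext hνν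
  refine ext_of_generate_finite _ (generateFrom_squareCylinders_cells Δ)
    (isPiSystem_squareCylinders (fun _ => isPiSystem_cells Δ) fun _ => Or.inl rfl) ?_ (by simp)
  rintro _ ⟨F, A, hA, rfl⟩
  -- Unconstrained coordinates are dropped, because piecewise uniformity speaks only of boxes all of
  -- whose sides lie in single cells.
  have hF : (F : Set V).pi A = ((F.filter fun g => A g ≠ Set.univ : Finset V) : Set V).pi A := by
    ext x
    simp only [Set.mem_pi, Finset.coe_filter, Set.mem_ofPred_eq]
    refine ⟨fun hx g hg => hx g hg.1, fun hx g hg => ?_⟩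
    by_cases hu : A g = Set.univ
    · simp [hu]
    · exact hx g ⟨hg, hu⟩
  simp only [hF]
  generalize hF' : (F.filter fun g => A g ≠ Set.univ) = F'
  have hA' : ∀ g, ∃ i, g ∈ F' → (A g).OrdConnected ∧ A g ⊆ Δ.cell i := by
    intro g
    rcases hA g trivial with hu | ⟨i, hi⟩
    · exact ⟨Δ.index 0, fun hg => by simp [← hF', hu] at hg⟩
    · exact ⟨i, fun _ => hi⟩
  choose c hc using hA'
  have hcells : (ν : Measure (V → UI)) ((F' : Set V).pi fun g => Δ.cell (c g))
      = (ν' : Measure (V → UI)) ((F' : Set V).pi fun g => Δ.cell (c g)) := by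
    have hpre : ((F' : Set V).pi fun g => Δ.cell (c g))
        = Δ.code ⁻¹' ((F' : Set V).pi fun g => {c g}) := by
      ext x
      simp [IntervalPartition.code, Δ.index_eq_iff]
    have hm : MeasurableSet ((F' : Set V).pi fun g => ({c g} : Set ι)) :=
      MeasurableSet.pi F'.countable_toSet fun g _ => measurableSet_singleton _
    rw [hpre, ← Measure.map_apply Δ.measurable_code hm, h,
      Measure.map_apply Δ.measurable_code hm]
  -- Comparison with the box of full cells: its mass is read off from the code, and its positive
  -- volume can be cancelled.
  have h1 := hν F' c A (fun g => Δ.cell (c g)) hc fun g _ => ⟨Δ.ordConnected _, subset_rfl⟩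
  have h2 := hν' F' c A (fun g => Δ.cell (c g)) hc fun g _ => ⟨Δ.ordConnected _, subset_rfl⟩
  rw [hcells, ← h2] at h1
  refine (ENNReal.mul_left_inj ?_ ?_).1 h1
  · exact Finset.prod_ne_zero_iff.2 fun g _ => (hΔ _).ne'
  · exact ENNReal.prod_ne_top fun g _ => measure_ne_top _ _

end PiecewiseUniform

/-! ### Lifting laws of configurations to piecewise uniform measures. -/

section Lift

variable {V : Type*} {K : ℕ}

instance : IsProbabilityMeasure (lebesgueProduct V) := by
  unfold lebesgueProduct
  infer_instance

theorem ae_lebesgueProduct_lt_one [Countable V] : ∀ᵐ u ∂lebesgueProduct V, ∀ g, u g < 1 :=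
  ae_all_iff.2 fun g =>
    (measurePreserving_eval_infinitePi (fun _ : V => (volume : Measure UI))
      g).quasiMeasurePreserving.ae ae_lt_one

/-- The point with code `z.1` whose relative positions in the cells are `z.2`. -/
noncomputable def decode (z : (V → Fin K) × (V → UI)) : V → UI := fun g => cellMap (z.1 g) (z.2 g)

theorem continuous_decode : Continuous (decode : (V → Fin K) × (V → UI) → V → UI) :=
  continuous_pi fun g => continuous_uncurry_cellMap.comp
    (f := fun z : (V → Fin K) × (V → UI) => (z.1 g, z.2 g)) (by fun_prop)

theorem measurable_uncurry_cellMap : Measurable fun z : Fin K × UI => cellMap z.1 z.2 :=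
  measurable_from_prod_countable_right fun a => (continuous_cellMap a).measurable

theorem measurable_decode : Measurable (decode : (V → Fin K) × (V → UI) → V → UI) :=
  measurable_pi_lambda _ fun g => measurable_uncurry_cellMap.comp
    (f := fun z : (V → Fin K) × (V → UI) => (z.1 g, z.2 g)) (by fun_prop)

theorem code_decode (hK : 0 < K) {z : (V → Fin K) × (V → UI)} (hz : ∀ g, z.2 g < 1) :
    (equalPartition hK).code (decode z) = z.1 :=
  funext fun g => (IntervalPartition.index_eq_iff _).2 (cellMap_mem hK _ (hz g))

/-- The measure on `[0,1]^V` for which the code has law `μ` and the relative positions in the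
cells are independent and uniformly distributed. -/
noncomputable def lift (μ : ProbabilityMeasure (V → Fin K)) : ProbabilityMeasure (V → UI) :=
  (μ.prod ⟨lebesgueProduct V, inferInstance⟩).map measurable_decode.aemeasurable

theorem coe_lift (μ : ProbabilityMeasure (V → Fin K)) :
    (lift μ : Measure (V → UI))
      = ((μ : Measure (V → Fin K)).prod (lebesgueProduct V)).map decode := rfl

theorem continuous_lift [Countable V] :
    Continuous (lift : ProbabilityMeasure (V → Fin K) → ProbabilityMeasure (V → UI)) := by
  let _ : TopologicalSpace.PseudoMetrizableSpace (V → Fin K) := inferInstance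
  let _ : TopologicalSpace.PseudoMetrizableSpace (V → UI) := inferInstance
  exact (ProbabilityMeasure.continuous_map continuous_decode).comp
    (ProbabilityMeasure.continuous_prod.comp (continuous_id.prodMk continuous_const))

theorem lift_pi (μ : ProbabilityMeasure (V → Fin K)) (F : Finset V) {A : V → Set UI}
    (hA : ∀ g ∈ F, MeasurableSet (A g)) :
    (lift μ : Measure (V → UI)) ((F : Set V).pi A)
      = ∫⁻ v, ∏ g ∈ F, volume (cellMap (v g) ⁻¹' A g) ∂(μ : Measure (V → Fin K)) := by
  have hm : MeasurableSet ((F : Set V).pi A) := MeasurableSet.pi F.countable_toSet hA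
  rw [coe_lift, Measure.map_apply measurable_decode hm,
    Measure.prod_apply (measurable_decode hm)]
  refine lintegral_congr fun v => ?_
  rw [← Measure.infinitePi_pi (fun _ => (volume : Measure UI))
    fun g hg => (continuous_cellMap (v g)).measurable (hA g hg)]
  rfl

theorem ae_prod_lt_one [Countable V] (μ : Measure (V → Fin K)) :
    ∀ᵐ z ∂μ.prod (lebesgueProduct V), ∀ g, z.2 g < 1 :=
  Measure.quasiMeasurePreserving_snd.ae ae_lebesgueProduct_lt_one

/-- Decoding then coding recovers the configuration unless some relative position equals 1;
countability of the vertex set makes this exceptional set null. -/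
theorem map_code_lift [Countable V] (hK : 0 < K) (μ : ProbabilityMeasure (V → Fin K)) :
    (lift μ : Measure (V → UI)).map (equalPartition hK).code = μ := by
  rw [coe_lift, Measure.map_map (equalPartition hK).measurable_code measurable_decode]
  have : (equalPartition hK).code ∘ decode
      =ᵐ[(μ : Measure (V → Fin K)).prod (lebesgueProduct V)] Prod.fst := by
    filter_upwards [ae_prod_lt_one (μ : Measure (V → Fin K))] with z hz
    exact code_decode hK hz
  rw [Measure.map_congr this, Measure.map_fst_prod]
  simp

/-- Within the product of the cells `c g`, a box has mass equal to its volume times a constant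
depending only on `F` and `c`: K^|F| times the probability that the configuration agrees with `c` on
`F`. -/
theorem lift_mem_piecewiseUniform (hK : 0 < K) (μ : ProbabilityMeasure (V → Fin K)) :
    lift μ ∈ piecewiseUniform V (equalPartition hK) := by
  intro F c A B hA hB
  have key : ∀ A : V → Set UI,
      (∀ g ∈ F, (A g).OrdConnected ∧ A g ⊆ (equalPartition hK).cell (c g)) →
      (lift μ : Measure (V → UI)) ((F : Set V).pi A)
        = (∫⁻ v, ∏ g ∈ F, (if v g = c g then (K : ENNReal) else 0) ∂(μ : Measure (V → Fin K)))
          * ∏ g ∈ F, volume (A g) := by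
    intro A hA
    rw [lift_pi μ F fun g hg => (hA g hg).1.measurableSet, ← lintegral_mul_const]
    · refine lintegral_congr fun v => ?_
      rw [← Finset.prod_mul_distrib]
      exact Finset.prod_congr rfl fun g hg => volume_preimage_cellMap hK _ _ (hA g hg).2
    · exact Finset.measurable_fun_prod _ fun g _ =>
        (Measurable.of_discrete (f := fun a => if a = c g then (K : ENNReal) else 0)).comp
          (measurable_pi_apply g)
  rw [key A hA, key B hB]
  ring

theorem lift_injective [Countable V] (hK : 0 < K) :
    Function.Injective
      (lift : ProbabilityMeasure (V → Fin K) → ProbabilityMeasure (V → UI)) := by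
  intro μ μ' h
  refine Subtype.ext ?_
  change (μ : Measure (V → Fin K)) = μ'
  rw [← map_code_lift hK μ, ← map_code_lift hK μ', h]

theorem exists_lift_eq [Countable V] (hK : 0 < K) {ν : ProbabilityMeasure (V → UI)}
    (hν : ν ∈ piecewiseUniform V (equalPartition hK)) :
    ∃ μ : ProbabilityMeasure (V → Fin K), lift μ = ν := by
  refine ⟨ν.map (equalPartition hK).measurable_code.aemeasurable, ?_⟩
  refine eq_of_map_code_eq (volume_cell_pos hK) (lift_mem_piecewiseUniform hK _) hν ?_
  rw [map_code_lift]
  rfl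

/-- `lift` is a homeomorphism onto the piecewise uniform measures. -/
noncomputable def liftHomeomorph [Countable V] (hK : 0 < K) :
    ProbabilityMeasure (V → Fin K) ≃ₜ piecewiseUniform V (equalPartition hK) :=
  -- The inverse is induced by the code, which jumps at the ends of cells. Its continuity comes
  -- instead from compactness of the space of laws on configurations.
  Continuous.homeoOfEquivCompactToT2
    (f := Equiv.ofBijective
      (fun μ => (⟨lift μ, lift_mem_piecewiseUniform hK μ⟩ :
        piecewiseUniform V (equalPartition hK)))
      ⟨fun _ _ h => lift_injective hK (congrArg Subtype.val h), fun ν =>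
        (exists_lift_eq hK ν.2).imp fun _ h => Subtype.ext h⟩)
    (continuous_lift.subtype_mk _)

@[simp] theorem coe_liftHomeomorph [Countable V] (hK : 0 < K)
    (μ : ProbabilityMeasure (V → Fin K)) :
    (liftHomeomorph hK μ : ProbabilityMeasure (V → UI)) = lift μ := rfl

theorem lebesgueProduct_mem_piecewiseUniform {ι : Type*} (Δ : IntervalPartition ι) :
    (⟨lebesgueProduct V, inferInstance⟩ : ProbabilityMeasure (V → UI)) ∈ piecewiseUniform V Δ := by
  intro F c A B hA hB
  change lebesgueProduct V _ * _ = lebesgueProduct V _ * _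
  rw [lebesgueProduct, Measure.infinitePi_pi _ fun g hg => (hA g hg).1.measurableSet,
    Measure.infinitePi_pi _ fun g hg => (hB g hg).1.measurableSet, mul_comm]

/-- On finite products, all the piecewise uniform measures are absolutely continuous. -/
theorem lift_absolutelyContinuous [Finite V] (hK : 0 < K) (μ : ProbabilityMeasure (V → Fin K)) :
    (lift μ : Measure (V → UI)) ≪ lebesgueProduct V := by
  have := Fintype.ofFinite V
  -- Lebesgue measure is the lift of a law μ₀ charging each of the configurations. Hence μ ≪ μ₀, and
  -- lifting preserves this.
  obtain ⟨μ₀, h⟩ := exists_lift_eq hK (lebesgueProduct_mem_piecewiseUniform (V := V) _)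
  have hpos : ∀ v, (μ₀ : Measure (V → Fin K)) {v} ≠ 0 := by
    intro v
    rw [← map_code_lift hK μ₀, h, Measure.map_apply (equalPartition hK).measurable_code
      (measurableSet_singleton v)]
    have hpre : (equalPartition hK).code ⁻¹' {v}
        = ((Finset.univ : Finset V) : Set V).pi fun g => (equalPartition hK).cell (v g) := by
      ext x
      simp [IntervalPartition.code, funext_iff, IntervalPartition.index_eq_iff]
    rw [hpre]
    change Measure.infinitePi _ _ ≠ 0
    rw [Measure.infinitePi_pi _ fun g _ => (equalPartition hK).measurableSet_cell _]
    exact Finset.prod_ne_zero_iff.2 fun g _ => (volume_cell_pos hK _).ne'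
  have hac : (μ : Measure (V → Fin K)) ≪ μ₀ := by
    refine Measure.AbsolutelyContinuous.mk fun s _ hs => ?_
    rcases s.eq_empty_or_nonempty with rfl | ⟨v, hv⟩
    · simp
    · exact absurd (measure_mono_null (Set.singleton_subset_iff.2 hv) hs) (hpos v)
  have h' : lebesgueProduct V = (lift μ₀ : Measure (V → UI)) := by rw [h]; rfl
  rw [h', coe_lift, coe_lift]
  exact (hac.prod Measure.AbsolutelyContinuous.rfl).map measurable_decode

end Lift

/-! ### The global map realizes the automaton; nonsingularity. -/

section Dynamics

variable {V : Type*} {G : SimpleGraph V} {K : ℕ}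

theorem measurable_localMap [G.LocallyFinite]
    {τ : (g : V) → (G.neighborSet g → Fin K) → UI → UI} (hτ : ∀ g c, Measurable (τ g c)) (g : V) :
    Measurable fun z : (V → Fin K) × UI => τ g (fun h => z.1 h) z.2 := by
  have h1 : Measurable fun z : (G.neighborSet g → Fin K) × UI => τ g z.1 z.2 :=
    measurable_from_prod_countable_right fun c => hτ g c
  have h2 : Measurable fun z : (V → Fin K) × UI =>
      ((fun h => z.1 h, z.2) : (G.neighborSet g → Fin K) × UI) :=
    Measurable.prodMk (by fun_prop) measurable_snd
  exact h1.comp h2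

theorem measurable_globalMap [G.LocallyFinite] (Δ : IntervalPartition (Fin K))
    {τ : (g : V) → (G.neighborSet g → Fin K) → UI → UI} (hτ : ∀ g c, Measurable (τ g c)) :
    Measurable (globalMap G Δ τ) :=
  measurable_pi_lambda _ fun g =>
    (measurable_localMap hτ g).comp (Δ.measurable_code.prodMk (measurable_pi_apply g))

theorem lintegral_stepLaw_prod (p : LocalRule G K) (v : V → Fin K) (F : Finset V)
    (f : V → Fin K → ENNReal) :
    ∫⁻ w, ∏ g ∈ F, f g (w g) ∂p.stepLaw v
      = ∏ g ∈ F, ∑ b, p g (v g) (fun h => v h) b * f g b := by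
  rw [LocalRule.stepLaw, ProbabilityTheory.lintegral_prod_eq_prod_lintegral_of_indepFun F
    (fun g (w : V → Fin K) => f g (w g)) (ProbabilityTheory.iIndepFun_infinitePi fun g => .of_discrete)
    fun g => (Measurable.of_discrete (f := f g)).comp (measurable_pi_apply g)]
  refine Finset.prod_congr rfl fun g _ => ?_
  rw [(measurePreserving_eval_infinitePi _ g).lintegral_comp (Measurable.of_discrete (f := f g)),
    lintegral_fintype]
  refine Finset.sum_congr rfl fun b _ => ?_
  rw [PMF.toMeasure_apply_singleton _ _ (measurableSet_singleton b), mul_comm]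

/-- If the local maps realize the local rule, then the global map realizes the automaton. -/
theorem inducedMap_lift [Countable V] [G.LocallyFinite] (hK : 0 < K) (p : LocalRule G K)
    {τ : (g : V) → (G.neighborSet g → Fin K) → UI → UI} (hτ : ∀ g c, Measurable (τ g c))
    (hp : ∀ g c a E, MeasurableSet E → volume ((fun u => τ g c (cellMap a u)) ⁻¹' E)
      = ∑ b, p g a c b * volume (cellMap b ⁻¹' E))
    (μ : ProbabilityMeasure (V → Fin K)) :
    inducedMap (measurable_globalMap (equalPartition hK) hτ) (lift μ) = lift (p.transfer μ) := by
  have hT := measurable_globalMap (equalPartition hK) hτ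
  suffices hνν : (inducedMap hT (lift μ) : Measure (V → UI)) = lift (p.transfer μ) from
    Subtype.ext hνν
  refine ext_of_generate_finite _
    (generateFrom_squareCylinders (α := fun _ : V => UI)).symm
    (isPiSystem_squareCylinders (fun _ => MeasurableSpace.isPiSystem_measurableSet)
      (by simp)) ?_ (by simp)
  rintro _ ⟨F, A, hA, rfl⟩
  have hA' : ∀ g, MeasurableSet (A g) := fun g => hA g trivial
  have hm : MeasurableSet ((F : Set V).pi A) :=
    MeasurableSet.pi F.countable_toSet fun g _ => hA' g
  -- `Ψ` reads the neighbour states directly from `z.1`. It agrees almost everywhere with the global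
  -- map after decoding, and for fixed `z.1` its coordinate at `g` depends only on `z.2 g`, which
  -- gives independence over the vertices.
  let Ψ : (V → Fin K) × (V → UI) → V → UI := fun z g => τ g (fun h => z.1 h) (decode z g)
  have hΨ : Measurable Ψ := measurable_pi_lambda _ fun g => (measurable_localMap hτ g).comp
    (measurable_fst.prodMk ((measurable_pi_apply g).comp measurable_decode))
  have hae : globalMap G (equalPartition hK) τ ∘ decode
      =ᵐ[(μ : Measure (V → Fin K)).prod (lebesgueProduct V)] Ψ := by
    filter_upwards [ae_prod_lt_one (μ : Measure (V → Fin K))] with z hz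
    have h := code_decode hK hz
    funext g
    change τ g (fun h => (equalPartition hK).code (decode z) h) _ = _
    rw [h]
  have hH : ∀ g, Measurable fun v : V → Fin K => volume (cellMap (v g) ⁻¹' A g) := fun g =>
    (Measurable.of_discrete (f := fun a => volume (cellMap a ⁻¹' A g))).comp
      (measurable_pi_apply g)
  change ((lift μ : Measure (V → UI)).map (globalMap G (equalPartition hK) τ)) _
    = (lift (p.transfer μ) : Measure (V → UI)) _
  rw [lift_pi _ F fun g _ => hA' g]
  change _ = ∫⁻ v, _ ∂((μ : Measure (V → Fin K)).bind p.stepLaw)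
  rw [Measure.lintegral_bind p.measurable_stepLaw.aemeasurable
      (Finset.measurable_fun_prod _ fun g _ => hH g).aemeasurable,
    coe_lift, Measure.map_map hT measurable_decode, Measure.map_congr hae,
    Measure.map_apply hΨ hm, Measure.prod_apply (hΨ hm)]
  refine lintegral_congr fun v => ?_
  rw [lintegral_stepLaw_prod p v F fun g b => volume (cellMap b ⁻¹' A g)]
  simp_rw [← hp _ _ _ _ (hA' _)]
  exact Measure.infinitePi_pi (s := F)
    (t := fun g => (fun u => τ g (fun h => v h) (cellMap (v g) u)) ⁻¹' A g)
    (fun _ => (volume : Measure UI))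
    fun g _ => ((hτ g _).comp (continuous_cellMap (v g)).measurable) (hA' g)

end Dynamics

/-- Every probability measure is absolutely continuous with respect to a probability measure for
which a given measurable map is nonsingular. -/
theorem exists_quasiMeasurePreserving {X : Type*} [MeasurableSpace X] {T : X → X}
    (hT : Measurable T) (ν : Measure X) [IsProbabilityMeasure ν] :
    ∃ m : Measure X, IsProbabilityMeasure m ∧ ν ≪ m ∧ Measure.QuasiMeasurePreserving T m m := by
  -- The weights are positive with sum 1. A set is `m`-null exactly when it is null for every
  -- iterate's image of ν, and taking preimages under T only shifts `n` to `n + 1`.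
  let m : Measure X := Measure.sum fun n : ℕ => (2⁻¹ : ENNReal) ^ (n + 1) • ν.map T^[n]
  have hm : ∀ s, MeasurableSet s → (m s = 0 ↔ ∀ n, ν.map T^[n] s = 0) := by
    intro s hs
    rw [Measure.sum_apply_eq_zero' hs]
    simp
  refine ⟨m, ⟨?_⟩, ?_, hT, ?_⟩
  · rw [Measure.sum_apply _ MeasurableSet.univ]
    have : ∀ n, (ν.map T^[n]) Set.univ = 1 := fun n => by
      rw [Measure.map_apply (hT.iterate n) MeasurableSet.univ, Set.preimage_univ, measure_univ]
    simp only [Measure.smul_apply, this, smul_eq_mul, mul_one]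
    rw [ENNReal.tsum_geometric_add_one, ENNReal.one_sub_inv_two, inv_inv,
      ENNReal.inv_mul_cancel two_ne_zero ENNReal.ofNat_ne_top]
  · refine Measure.AbsolutelyContinuous.mk fun s hs h => ?_
    simpa using (hm s hs).1 h 0
  · refine Measure.AbsolutelyContinuous.mk fun s hs h => ?_
    rw [Measure.map_apply hT hs, hm _ (hT hs)]
    intro n
    have := (hm s hs).1 h (n + 1)
    rwa [Function.iterate_succ', ← Measure.map_map hT (hT.iterate n),
      Measure.map_apply hT hs] at this

theorem theoremt {V : Type*} [Countable V] (G : SimpleGraph V) [G.LocallyFinite]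
    (K : ℕ) (hK : 1 ≤ K) (p : LocalRule G K) :
    ∃ (Δ : IntervalPartition (Fin K)) (τ : (g : V) → (G.neighborSet g → Fin K) → UI → UI),
      (∀ i, 0 < volume (Δ.cell i)) ∧
      -- countably many local maps, all of them piecewise linear Markov maps
      {f : UI → UI | ∃ g c, f = τ g c}.Countable ∧
      (∀ g c, IsPiecewiseLinearMarkov Δ (τ g c)) ∧
      -- the global map is nonsingular with respect to a reference measure
      (∃ m : Measure (V → UI), IsProbabilityMeasure m ∧ lebesgueProduct V ≪ m ∧
        (Finite V → m = lebesgueProduct V) ∧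
        Measure.QuasiMeasurePreserving (globalMap G Δ τ) m m) ∧
      -- the automaton is equivalent to the global map on the piecewise uniform measures
      ∃ (hT : Measurable (globalMap G Δ τ))
        (π : ProbabilityMeasure (V → Fin K) ≃ₜ piecewiseUniform V Δ),
        IsEquivalence p.transfer hT (piecewiseUniform V Δ) π ∧
        ∀ μ : ProbabilityMeasure (V → Fin K),
          ((π μ : ProbabilityMeasure (V → UI)) : Measure (V → UI)).map Δ.code
            = (μ : Measure (V → Fin K)) := by
  classical
  have hK' : 0 < K := hK
  let τ : (g : V) → (G.neighborSet g → Fin K) → UI → UI :=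
    fun g c => markovMap (fun a => p g a c) hK'
  have hτ : ∀ g c, IsPiecewiseLinearMarkov (equalPartition hK') (τ g c) :=
    fun g c => isPiecewiseLinearMarkov_markovMap _ hK'
  have hT := measurable_globalMap (equalPartition hK') fun g c => (hτ g c).measurable
  have hconj : ∀ μ, inducedMap hT (lift μ) = lift (p.transfer μ) :=
    inducedMap_lift hK' p (fun g c => (hτ g c).measurable)
      fun g c a _ hE => volume_preimage_markovMap (fun a => p g a c) hK' a hE
  refine ⟨equalPartition hK', τ, volume_cell_pos hK', ?_, hτ, ?_, hT, liftHomeomorph hK',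
    ⟨fun μ => (hconj μ).symm, fun ν => ?_⟩, map_code_lift hK'⟩
  · refine (Set.countable_range
      fun gc : (g : V) × (G.neighborSet g → Fin K) => τ gc.1 gc.2).mono ?_
    rintro _ ⟨g, c, rfl⟩
    exact ⟨⟨g, c⟩, rfl⟩
  · by_cases hV : Finite V
    · refine ⟨lebesgueProduct V, inferInstance, .rfl, fun _ => rfl, hT, ?_⟩
      -- As Lebesgue measure is a lift, so is its image under T, and on a finite product every lift
      -- is absolutely continuous.
      obtain ⟨μ, h⟩ := exists_lift_eq hK' (lebesgueProduct_mem_piecewiseUniform (V := V) _)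
      have h' : (lebesgueProduct V).map (globalMap G (equalPartition hK') τ)
          = (lift (p.transfer μ) : Measure (V → UI)) := by
        rw [← hconj μ, h]
        rfl
      rw [h']
      exact lift_absolutelyContinuous hK' _
    · obtain ⟨m, h1, h2, h3⟩ := exists_quasiMeasurePreserving hT (lebesgueProduct V)
      exact ⟨m, h1, h2, fun h => absurd h hV, h3⟩
  · obtain ⟨μ, rfl⟩ := (liftHomeomorph hK').surjective ν
    refine ⟨?_, ?_⟩
    · rw [coe_liftHomeomorph, hconj]
      exact lift_mem_piecewiseUniform hK' _
    · rw [Homeomorph.symm_apply_apply, Homeomorph.eq_symm_apply]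
      exact Subtype.ext (hconj μ).symm
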